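/- Let $\Phi=\{x_j\}$ be a homogeneous Poisson point process in $\mathbb{R}^2$ of intensity $\lambda>0$, put $r_j=\|x_j\|$, and let $\eta>2$. Attach to each point a transmit power $P_j\ge 0$, a protection radius $a_j\ge 0$ and a channel power gain $h_j$ such that the pairs $(P_j,a_j)$ are i.i.d. copies of a random pair $(P,a)$ (so $a_j$ may be constant, or may depend on $P_j$), the $h_j$ are i.i.d. exponential random variables with mean $1$, and $\Phi$, $(P_j,a_j)_j$ and $(h_j)_j$ are independent. Let $$\mathfrak{I}=\sum_j P_j h_j r_j^{-\eta}\,\mathbf{1}\{r_j>a_j\}\in[0,\infty]$$ be the aggregate interference at the origin and $\mathcal{L}_{\mathfrak I}(s)=\mathbb{E}[e^{-s\mathfrak I}]$, $s\ge 0$, its Laplace transform, with the conventions $0\cdot\infty=0$ and $e^{-\infty}=0$. If $a>0$ almost surely, then for every $s\ge 0$ $$\mathcal{L}_{\mathfrak I}(s)=\exp\left(-\frac{2\pi\lambda}{\eta-2}\,\mathbb{E}\left[a^{2-\eta}\,s\,P\;{}_2F_1\left(1,1-\tfrac{2}{\eta};2-\tfrac{2}{\eta};-a^{-\eta}Ps\right)\right]\right),$$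 where the expectation is over $(P,a)$ (so over $P$ if $a$ is a constant or a function of $P$) and ${}_2F_1$ is the Gauss hypergeometric function, i.e. the analytic continuation of the hypergeometric series to $(-\infty,1)$. If $a=0$ almost surely (no exclusion region), then for every $s\ge 0$ $$\mathcal{L}_{\mathfrak I}(s)=\exp\left(-\frac{2\pi^2\lambda}{\eta}\,\mathbb{E}\left[(sP)^{2/\eta}\right]\csc\left(\frac{2\pi}{\eta}\right)\right).$$ In both formulas, if the expectation on the right-hand side is infinite, then $\mathcal{L}_{\mathfrak I}(s)=0$. -/

import Mathlib

open MeasureTheory ProbabilityTheory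
open scoped ENNReal NNReal

/-- `F` is a real-analytic function on `(-∞, 1)` that agrees on `(-1, 1)` with the sum of the
Gauss hypergeometric series with parameters `a, b; c`. -/
def IsGaussContinuation (a b c : ℝ) (F : ℝ → ℝ) : Prop :=
  AnalyticOnNhd ℝ F (Set.Iio 1) ∧ Set.EqOn F (ordinaryHypergeometric a b c) (Set.Ioo (-1) 1)

/-- There is at most one such continuation to `(-∞, 1)`. -/
theorem IsGaussContinuation.eqOn {a b c : ℝ} {F G : ℝ → ℝ}
    (hF : IsGaussContinuation a b c F) (hG : IsGaussContinuation a b c G) :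
    Set.EqOn F G (Set.Iio 1) := by
  refine hF.1.eqOn_of_preconnected_of_eventuallyEq hG.1 isPreconnected_Iio
    (z₀ := 0) (by simp) ?_
  filter_upwards [Ioo_mem_nhds (show (-1 : ℝ) < 0 by norm_num) (show (0 : ℝ) < 1 by norm_num)]
    with x hx
  rw [hF.2 hx, hG.2 hx]

open Classical in
/-- The Gauss hypergeometric function `₂F₁(a, b; c; x)` for real `x < 1`: the analytic
continuation to `(-∞, 1)` of the hypergeometric series. (Mathlib's `ordinaryHypergeometric` is the
sum of the series and has a junk value for `|x| > 1`.) -/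
noncomputable def gaussHypergeometric (a b c x : ℝ) : ℝ :=
  if H : ∃ F : ℝ → ℝ, IsGaussContinuation a b c F then H.choose x else 0

/-- The function `gaussHypergeometric` is the continuation, whenever there is one. -/
theorem IsGaussContinuation.gaussHypergeometric_eq {a b c : ℝ} {F : ℝ → ℝ}
    (hF : IsGaussContinuation a b c F) {x : ℝ} (hx : x < 1) :
    gaussHypergeometric a b c x = F x := by
  have H : ∃ F : ℝ → ℝ, IsGaussContinuation a b c F := ⟨F, hF⟩
  rw [gaussHypergeometric, dif_pos H]
  exact H.choose_spec.eqOn hF hx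

/-- The Euclidean plane. -/
abbrev Plane : Type := EuclideanSpace ℝ (Fin 2)

/-- The number of points of the configuration `(X j ω)` that lie in `B`, with multiplicity. -/
noncomputable def pointCount {Ω : Type*} (X : ℕ → Ω → Plane) (B : Set Plane) (ω : Ω) : ℕ∞ :=
  Set.encard {j : ℕ | X j ω ∈ B}

/-- The random points `X 0, X 1, …` form a homogeneous Poisson point process of intensity `lam` in
the plane: the number of points in a bounded Borel set is Poisson distributed with mean `lam` times
the area, and the numbers of points in disjoint bounded Borel sets are independent. -/
structure IsHomogeneousPPP {Ω : Type*} [MeasurableSpace Ω] (Pr : Measure Ω) (lam : ℝ≥0)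
    (X : ℕ → Ω → Plane) : Prop where
  measurable : ∀ j, Measurable (X j)
  count_law : ∀ B : Set Plane, MeasurableSet B → Bornology.IsBounded B → ∀ n : ℕ,
    Pr {ω | pointCount X B ω = (n : ℕ∞)} = poissonMeasure (lam * (volume B).toNNReal) {n}
  count_indep : ∀ (m : ℕ) (B : Fin m → Set Plane), (∀ i, MeasurableSet (B i)) →
    (∀ i, Bornology.IsBounded (B i)) → Pairwise (fun i k => Disjoint (B i) (B k)) →
    iIndepFun (fun i => pointCount X (B i)) Pr

/-- A field of interferers around a receiver at the origin. The positions `X j` form a homogeneous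
Poisson point process of intensity `lam`; interferer `j` has transmit power `P j`, protection
radius `a j` and channel power gain `h j`. The pairs `(P j, a j)` are i.i.d. with law `ν` (the radius
may depend on the power), the gains are i.i.d. exponential with mean one (Rayleigh fading), and the
positions, the pairs `(P j, a j)` and the gains are independent of each other. -/
structure IsInterfererField {Ω : Type*} [MeasurableSpace Ω] (Pr : Measure Ω) (lam : ℝ≥0)
    (ν : Measure (ℝ × ℝ)) (X : ℕ → Ω → Plane) (P a h : ℕ → Ω → ℝ) : Prop where
  ppp : IsHomogeneousPPP Pr lam X
  measurable_power : ∀ j, Measurable (P j)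
  measurable_radius : ∀ j, Measurable (a j)
  measurable_gain : ∀ j, Measurable (h j)
  mark_law : ∀ j, HasLaw (fun ω => (P j ω, a j ω)) ν Pr
  mark_indep : iIndepFun (fun j ω => (P j ω, a j ω)) Pr
  gain_law : ∀ j, HasLaw (h j) (expMeasure 1) Pr
  gain_indep : iIndepFun h Pr
  indep_marks_gains : IndepFun (fun ω (j : ℕ) => (P j ω, a j ω)) (fun ω (j : ℕ) => h j ω) Pr
  indep_points : IndepFun (fun ω (j : ℕ) => X j ω)
    (fun ω (j : ℕ) => ((P j ω, a j ω), h j ω)) Pr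

/-- The aggregate interference at the origin with path loss exponent `η`,
`∑ j, P j * h j * ‖X j‖ ^ (-η) * 1{‖X j‖ > a j}`, as a sum in `[0, ∞]`. -/
noncomputable def aggregateInterference {Ω : Type*} (η : ℝ) (X : ℕ → Ω → Plane)
    (P a h : ℕ → Ω → ℝ) (ω : Ω) : ℝ≥0∞ :=
  ∑' j : ℕ, ENNReal.ofReal
    (if a j ω < ‖X j ω‖ then P j ω * h j ω * ‖X j ω‖ ^ (-η) else 0)

open Classical in
/-- `exp (-x)` for `x` in `[0, ∞]`, with `exp (-∞) = 0`. -/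
noncomputable def expNeg (x : ℝ≥0∞) : ℝ :=
  if x = ∞ then 0 else Real.exp (-x.toReal)

/-- The Laplace transform `E[exp (-s I)]` of a random variable `I` with values in `[0, ∞]`, at real
`s ≥ 0` (with `0 * ∞ = 0`). -/
noncomputable def laplaceTransform {Ω : Type*} [MeasurableSpace Ω] (Pr : Measure Ω)
    (I : Ω → ℝ≥0∞) (s : ℝ) : ℝ :=
  ∫ ω, expNeg (ENNReal.ofReal s * I ω) ∂Pr

/-- The function `a ^ (2 - η) s p ₂F₁(1, 1 - 2/η; 2 - 2/η; -a ^ (-η) p s)` of the transmit power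
`p` and the protection radius `a`. -/
noncomputable def exclusionTerm (η s p a : ℝ) : ℝ :=
  a ^ (2 - η) * s * p * gaussHypergeometric 1 (1 - 2 / η) (2 - 2 / η) (-(a ^ (-η) * p * s))

/-! A Poisson process has the Laplace functional E exp(-∑ g(x_j)) = exp(-λ ∫ (1 - e^{-g})). For g
simple on a bounded set this is independence of the counts of its level sets plus the Poisson
generating function; monotone approximation reaches every measurable g with values in [0, ∞]
(`IsHomogeneousPPP.lintegral_eexpNeg`). Independent marks only replace e^{-g(x)} by its average over
the mark (`IsInterfererField.lintegral_eexpNeg`).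

Averaging over an exponential gain turns e^{-zhy} into 1/(1 + zy), where z = sP and y = r^{-η}. By
Tonelli the exponent is λ times the expectation over (P, a) of the planar integral of zy/(1 + zy)
over r > a. Polar coordinates and the substitution y = r^{-η} make that integral (2π/η) ∫ y^{-2/η-1}
zy/(1 + zy) dy over 0 < y < a^{-η}. With b = 1 - 2/η it is Euler's integral for ₂F₁(1, b; b+1; ·)
when a > 0, and the beta integral π / sin(πb) when a = 0.

Everything is computed in [0, ∞] with the continuous function `eexpNeg`, which vanishes at ∞, so
infinite expectations need no separate limiting argument. -/

/-! ### The exponential on [0, ∞] and the Poisson generating function -/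

/-- `exp (-x)` for `x` in `[0, ∞]`, as an extended nonnegative real. -/
noncomputable def eexpNeg (x : ℝ≥0∞) : ℝ≥0∞ := EReal.exp (-(x : EReal))

theorem expNeg_nonneg (x : ℝ≥0∞) : 0 ≤ expNeg x := by
  unfold expNeg; split_ifs <;> positivity

theorem ofReal_expNeg (x : ℝ≥0∞) : ENNReal.ofReal (expNeg x) = eexpNeg x := by
  induction x with
  | top => simp [expNeg, eexpNeg]
  | coe x =>
    have : (((x : ℝ≥0∞) : EReal)) = ((x : ℝ) : EReal) := rfl
    simp only [expNeg, eexpNeg, ENNReal.coe_ne_top, if_false, ENNReal.coe_toReal, this]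
    rw [← EReal.coe_neg, EReal.exp_coe]

theorem toReal_eexpNeg (x : ℝ≥0∞) : (eexpNeg x).toReal = expNeg x := by
  rw [← ofReal_expNeg, ENNReal.toReal_ofReal (expNeg_nonneg x)]

@[simp] theorem eexpNeg_zero : eexpNeg 0 = 1 := by simp [eexpNeg]

theorem eexpNeg_ofReal {r : ℝ} (hr : 0 ≤ r) :
    eexpNeg (ENNReal.ofReal r) = ENNReal.ofReal (Real.exp (-r)) := by
  rw [← ofReal_expNeg]
  simp [expNeg, ENNReal.toReal_ofReal hr]

theorem eexpNeg_add (x y : ℝ≥0∞) : eexpNeg (x + y) = eexpNeg x * eexpNeg y := by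
  unfold eexpNeg
  rw [← EReal.exp_add, EReal.coe_ennreal_add, EReal.neg_add, sub_eq_add_neg] <;> simp

theorem eexpNeg_antitone : Antitone eexpNeg := fun x y h => by
  unfold eexpNeg
  simpa using h

theorem eexpNeg_le_one (x : ℝ≥0∞) : eexpNeg x ≤ 1 := by
  simpa using eexpNeg_antitone (zero_le (a := x))

theorem eexpNeg_ne_top (x : ℝ≥0∞) : eexpNeg x ≠ ∞ :=
  ((eexpNeg_le_one x).trans_lt ENNReal.one_lt_top).ne

theorem continuous_eexpNeg : Continuous eexpNeg := by
  unfold eexpNeg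
  exact ENNReal.continuous_exp.comp (continuous_neg.comp continuous_coe_ennreal_ereal)

@[fun_prop] theorem measurable_eexpNeg : Measurable eexpNeg := continuous_eexpNeg.measurable

theorem eexpNeg_sum {ι : Type*} (t : Finset ι) (f : ι → ℝ≥0∞) :
    eexpNeg (∑ i ∈ t, f i) = ∏ i ∈ t, eexpNeg (f i) := by
  classical
  induction t using Finset.induction_on with
  | empty => simp
  | insert i t hi ih => rw [Finset.sum_insert hi, Finset.prod_insert hi, eexpNeg_add, ih]

theorem eexpNeg_nsmul (n : ℕ) (x : ℝ≥0∞) : eexpNeg (n * x) = eexpNeg x ^ n := by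
  simpa using eexpNeg_sum (Finset.range n) (fun _ => x)

theorem tendsto_prod_eexpNeg (f : ℕ → ℝ≥0∞) :
    Filter.Tendsto (fun n => ∏ j ∈ Finset.range n, eexpNeg (f j)) Filter.atTop
      (nhds (eexpNeg (∑' j, f j))) := by
  simp_rw [← eexpNeg_sum]
  exact (continuous_eexpNeg.tendsto _).comp ENNReal.summable.hasSum.tendsto_sum_nat

/-- `-log y` for `y` in `[0, 1]`, with values in `[0, ∞]`. -/
noncomputable def eNegLog (y : ℝ≥0∞) : ℝ≥0∞ := (-ENNReal.log y).toENNReal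

theorem eexpNeg_eNegLog {y : ℝ≥0∞} (hy : y ≤ 1) : eexpNeg (eNegLog y) = y := by
  unfold eexpNeg eNegLog
  rw [EReal.coe_toENNReal, neg_neg, ENNReal.exp_log]
  rw [EReal.le_neg, neg_zero]
  simpa using ENNReal.log_monotone hy

@[fun_prop] theorem measurable_eNegLog : Measurable eNegLog := by
  unfold eNegLog
  fun_prop

/-- With q = e^{-c}, this is the exponential series ∑ q^n e^{-r} r^n / n!. The value c = ∞ is
included: there q = 0, and 0 * ∞ = 0 matches q^0 = 1. -/
theorem lintegral_eexpNeg_poissonMeasure (r : ℝ≥0) (c : ℝ≥0∞) :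
    ∫⁻ n : ℕ, eexpNeg (c * n) ∂(poissonMeasure r) = eexpNeg (r * (1 - eexpNeg c)) := by
  set q : ℝ := (eexpNeg c).toReal with hq
  have hqe : eexpNeg c = ENNReal.ofReal q := by rw [ENNReal.ofReal_toReal (eexpNeg_ne_top c)]
  have hq0 : 0 ≤ q := ENNReal.toReal_nonneg
  have hq1 : q ≤ 1 := by
    have := ENNReal.toReal_mono ENNReal.one_ne_top (eexpNeg_le_one c); simpa using this
  have h1 : ((r : ℝ≥0∞) * (1 - eexpNeg c)) = ENNReal.ofReal (r * (1 - q)) := by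
    rw [hqe, ENNReal.ofReal_mul r.coe_nonneg, ENNReal.ofReal_sub _ hq0]
    simp
  rw [h1, eexpNeg_ofReal (by exact mul_nonneg r.coe_nonneg (by linarith)), lintegral_countable']
  have hs : HasSum (fun n : ℕ => q ^ n * (Real.exp (-r) * r ^ n / n.factorial))
      (Real.exp (-(r * (1 - q)))) := by
    have := (NormedSpace.expSeries_div_hasSum_exp (𝔸 := ℝ) (q * r)).mul_left (Real.exp (-r))
    rw [← Real.exp_eq_exp_ℝ, ← Real.exp_add] at this
    have e : -(r : ℝ) + q * r = -(r * (1 - q)) := by ring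
    rw [e] at this
    refine this.congr_fun ?_
    intro n; ring
  rw [← hs.tsum_eq, ENNReal.ofReal_tsum_of_nonneg (fun n => by positivity) hs.summable]
  congr 1 with n
  rw [mul_comm c, eexpNeg_nsmul, hqe, poissonMeasure_singleton, ENNReal.ofReal_mul (by positivity),
    ENNReal.ofReal_pow hq0]

/-! ### The Laplace functional of the Poisson process -/

section PointProcess

theorem toENNReal_pointCount {Ω : Type*} (X : ℕ → Ω → Plane) (B : Set Plane) (ω : Ω) :
    (pointCount X B ω : ℝ≥0∞) = ∑' j, B.indicator 1 (X j ω) := by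
  rw [pointCount, ← ENNReal.tsum_set_one, tsum_subtype {j : ℕ | X j ω ∈ B} (fun _ => (1 : ℝ≥0∞))]
  rfl

variable {Ω : Type*} [MeasurableSpace Ω]

theorem measurable_pointCount {X : ℕ → Ω → Plane} (hX : ∀ j, Measurable (X j)) {B : Set Plane}
    (hB : MeasurableSet B) : Measurable (pointCount X B) := by
  have h : Measurable fun ω => (pointCount X B ω : ℝ≥0∞) := by
    simp_rw [toENNReal_pointCount]
    exact Measurable.tsum fun j => (measurable_one.indicator hB).comp (hX j)
  rw [ENat.measurable_iff]
  intro n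
  have : pointCount X B ⁻¹' {(n : ℕ∞)} = (fun ω => (pointCount X B ω : ℝ≥0∞)) ⁻¹' {(n : ℝ≥0∞)} := by
    ext ω
    simp only [Set.mem_preimage, Set.mem_singleton_iff]
    rw [← ENat.toENNReal_coe, ENat.toENNReal_inj]
  rw [this]
  exact h (measurableSet_singleton _)

/-- Total mass one forces the mass at ⊤. The Poisson law is prescribed only at finite counts, and
this excludes an infinite count almost surely. -/
theorem ENat.measure_ext_of_isProbabilityMeasure {μ ν : Measure ℕ∞} [IsProbabilityMeasure μ]
    [IsProbabilityMeasure ν] (h : ∀ n : ℕ, μ {(n : ℕ∞)} = ν {(n : ℕ∞)}) : μ = ν := by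
  have hU : ({⊤}ᶜ : Set ℕ∞) = ⋃ n : ℕ, {(n : ℕ∞)} := by
    ext x
    induction x <;> simp
  have hd : Pairwise (Function.onFun Disjoint fun n : ℕ => ({(n : ℕ∞)} : Set ℕ∞)) := by
    intro m n hmn
    simpa [Function.onFun] using hmn
  have hc : μ {⊤}ᶜ = ν {⊤}ᶜ := by
    rw [hU, measure_iUnion hd fun _ => .of_discrete, measure_iUnion hd fun _ => .of_discrete]
    simp_rw [h]
  refine Measure.ext_of_singleton fun x => ?_
  induction x with
  | top =>
    rw [← compl_compl ({⊤} : Set ℕ∞), prob_compl_eq_one_sub (s := {⊤}ᶜ) .of_discrete, hc,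
      ← prob_compl_eq_one_sub (s := {⊤}ᶜ) .of_discrete]
  | coe n => exact h n

variable {Pr : Measure Ω} [IsProbabilityMeasure Pr] {lam : ℝ≥0} {X : ℕ → Ω → Plane}

theorem IsHomogeneousPPP.map_pointCount (hX : IsHomogeneousPPP Pr lam X) {B : Set Plane}
    (hB : MeasurableSet B) (hb : Bornology.IsBounded B) :
    Pr.map (pointCount X B) = (poissonMeasure (lam * (volume B).toNNReal)).map (↑) := by
  have hm := measurable_pointCount hX.measurable hB
  have := Measure.isProbabilityMeasure_map (μ := Pr) hm.aemeasurable
  have := Measure.isProbabilityMeasure_map (μ := poissonMeasure (lam * (volume B).toNNReal))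
    (f := ((↑) : ℕ → ℕ∞)) Measurable.of_discrete.aemeasurable
  refine ENat.measure_ext_of_isProbabilityMeasure fun n => ?_
  rw [Measure.map_apply hm .of_discrete, Measure.map_apply .of_discrete .of_discrete]
  refine (hX.count_law B hB hb n).trans ?_
  congr 1
  ext m
  simp

theorem IsHomogeneousPPP.lintegral_eexpNeg_pointCount (hX : IsHomogeneousPPP Pr lam X)
    {B : Set Plane} (hB : MeasurableSet B) (hb : Bornology.IsBounded B) (c : ℝ≥0∞) :
    ∫⁻ ω, eexpNeg (c * pointCount X B ω) ∂Pr = eexpNeg (lam * ((1 - eexpNeg c) * volume B)) := by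
  have hm := measurable_pointCount hX.measurable hB
  have h1 := lintegral_map (μ := Pr) (f := fun n : ℕ∞ => eexpNeg (c * n)) .of_discrete hm
  rw [hX.map_pointCount hB hb, lintegral_map .of_discrete .of_discrete] at h1
  rw [← h1]
  simp only [ENat.toENNReal_coe]
  rw [lintegral_eexpNeg_poissonMeasure, ENNReal.coe_mul,
    ENNReal.coe_toNNReal hb.measure_lt_top.ne, mul_assoc, mul_comm (volume B)]

theorem IsHomogeneousPPP.lintegral_eexpNeg_sum (hX : IsHomogeneousPPP Pr lam X)
    {ι : Type*} [Fintype ι] {B : ι → Set Plane} (hB : ∀ i, MeasurableSet (B i))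
    (hb : ∀ i, Bornology.IsBounded (B i)) (hd : Pairwise fun i k => Disjoint (B i) (B k))
    (c : ι → ℝ≥0∞) :
    ∫⁻ ω, eexpNeg (∑ i, c i * pointCount X (B i) ω) ∂Pr =
      eexpNeg (lam * ∑ i, (1 - eexpNeg (c i)) * volume (B i)) := by
  let e := Fintype.equivFin ι
  have hi : iIndepFun (fun i => pointCount X (B i)) Pr := by
    have := hX.count_indep _ (fun k => B (e.symm k)) (fun k => hB _) (fun k => hb _)
      (fun k l hkl => hd (e.symm.injective.ne hkl))
    simpa using this.precomp e.injective
  have hi' := hi.comp (fun i (n : ℕ∞) => eexpNeg (c i * n)) fun i => .of_discrete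
  simp_rw [eexpNeg_sum, Finset.mul_sum, eexpNeg_sum]
  refine (lintegral_prod_eq_prod_lintegral_of_indepFun Finset.univ _ hi' fun i => Measurable.comp
    .of_discrete (measurable_pointCount hX.measurable (hB i))).trans ?_
  exact Finset.prod_congr rfl fun i _ => hX.lintegral_eexpNeg_pointCount (hB i) (hb i) (c i)

/-- The level sets of `f` inside `D` are disjoint, and bounded because `D` is, so their counts are
independent Poisson variables. -/
theorem IsHomogeneousPPP.lintegral_eexpNeg_simpleFunc (hX : IsHomogeneousPPP Pr lam X)
    (f : SimpleFunc Plane ℝ≥0∞) {D : Set Plane} (hD : MeasurableSet D)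
    (hb : Bornology.IsBounded D) :
    ∫⁻ ω, eexpNeg (∑' j, D.indicator f (X j ω)) ∂Pr =
      eexpNeg (lam * ∫⁻ x in D, 1 - eexpNeg (f x)) := by
  have h := hX.lintegral_eexpNeg_sum (B := fun v : f.range => f ⁻¹' {(v : ℝ≥0∞)} ∩ D)
    (fun v => (f.measurableSet_preimage _).inter hD) (fun v => hb.subset Set.inter_subset_right)
    (fun u v huv => ((Disjoint.preimage _ (Set.disjoint_singleton.mpr fun h => huv (Subtype.ext h))).mono
      Set.inter_subset_left Set.inter_subset_left)) (fun v => v)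
  have h2 : ∫⁻ x in D, 1 - eexpNeg (f x) =
      ∑ v : f.range, (1 - eexpNeg v) * volume (f ⁻¹' {(v : ℝ≥0∞)} ∩ D) := by
    have := SimpleFunc.map_lintegral (μ := volume.restrict D) (fun v => 1 - eexpNeg v) f
    rw [← SimpleFunc.lintegral_eq_lintegral, ← Finset.sum_coe_sort] at this
    simp only [SimpleFunc.coe_map, Function.comp_apply] at this
    rw [this]
    exact Finset.sum_congr rfl fun v _ => by
      rw [Measure.restrict_apply (f.measurableSet_preimage _)]
  rw [h2, ← h]
  congr 1 with ω
  simp_rw [toENNReal_pointCount, ← ENNReal.tsum_mul_left]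
  -- After the exchange of sums, each point meets only the level set of its own value.
  rw [← tsum_fintype (L := .unconditional _), ENNReal.tsum_comm]
  congr 2 with j
  rw [tsum_fintype]
  by_cases hj : X j ω ∈ D
  · rw [Finset.sum_eq_single ⟨f (X j ω), SimpleFunc.mem_range_self f _⟩]
    · simp [hj]
    · intro v _ hv
      have : f (X j ω) ≠ v := fun h => hv (by simp [h])
      simp [this]
    · simp
  · simp [hj]

/-- The Laplace functional of a homogeneous Poisson point process. -/
theorem IsHomogeneousPPP.lintegral_eexpNeg (hX : IsHomogeneousPPP Pr lam X)
    {g : Plane → ℝ≥0∞} (hg : Measurable g) :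
    ∫⁻ ω, eexpNeg (∑' j, g (X j ω)) ∂Pr = eexpNeg (lam * ∫⁻ x, 1 - eexpNeg (g x)) := by
  -- Cutting off to the ball of radius n gives bounded support, and the cut-off approximations still
  -- increase to `g`.
  let f (n : ℕ) : Plane → ℝ≥0∞ := (Metric.ball 0 n).indicator (SimpleFunc.eapprox g n)
  have hfm (n : ℕ) : Measurable (f n) :=
    (SimpleFunc.measurable _).indicator Metric.isOpen_ball.measurableSet
  have hmono (x : Plane) : Monotone fun n => f n x := by
    intro m n hmn
    refine (Set.indicator_le_indicator (SimpleFunc.monotone_eapprox g hmn x)).trans ?_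
    exact Set.indicator_le_indicator_of_subset (Metric.ball_subset_ball (by exact_mod_cast hmn))
      (fun _ => zero_le) x
  have hlim (x : Plane) : Filter.Tendsto (fun n => f n x) Filter.atTop (nhds (g x)) := by
    have h1 := tendsto_atTop_iSup (fun m n hmn => SimpleFunc.monotone_eapprox g hmn x :
      Monotone fun n => SimpleFunc.eapprox g n x)
    rw [SimpleFunc.iSup_eapprox_apply hg] at h1
    refine h1.congr' ?_
    obtain ⟨N, hN⟩ := exists_nat_gt ‖x‖
    filter_upwards [Filter.eventually_ge_atTop N] with n hn
    have : x ∈ Metric.ball (0 : Plane) n := by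
      simpa using hN.trans_le (by exact_mod_cast hn)
    simp only [f, Set.indicator_of_mem this]
  have hsup (x : Plane) : ⨆ n, f n x = g x :=
    tendsto_nhds_unique (tendsto_atTop_iSup (hmono x)) (hlim x)
  have hkey (n : ℕ) : ∫⁻ ω, eexpNeg (∑' j, f n (X j ω)) ∂Pr =
      eexpNeg (lam * ∫⁻ x, 1 - eexpNeg (f n x)) := by
    rw [hX.lintegral_eexpNeg_simpleFunc _ Metric.isOpen_ball.measurableSet Metric.isBounded_ball,
      ← lintegral_indicator Metric.isOpen_ball.measurableSet]
    congr 3 with x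
    by_cases hx : x ∈ Metric.ball (0 : Plane) n <;> simp only [f, Set.indicator, hx, if_true,
      if_false, eexpNeg_zero, tsub_self]
  have hL : Filter.Tendsto (fun n => ∫⁻ ω, eexpNeg (∑' j, f n (X j ω)) ∂Pr) Filter.atTop
      (nhds (∫⁻ ω, eexpNeg (∑' j, g (X j ω)) ∂Pr)) := by
    refine tendsto_lintegral_of_dominated_convergence 1 (fun n => ?_)
      (fun n => .of_forall fun ω => eexpNeg_le_one _) (by simp) (.of_forall fun ω => ?_)
    · exact measurable_eexpNeg.comp (Measurable.tsum fun j => (hfm n).comp (hX.measurable j))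
    · refine (continuous_eexpNeg.tendsto _).comp ?_
      -- Monotone convergence for the counting measure on the indices.
      have : ∑' j, g (X j ω) = ⨆ n, ∑' j, f n (X j ω) := by
        simp_rw [← hsup, ← lintegral_count]
        exact lintegral_iSup (fun n => .of_discrete) fun m n hmn j => hmono _ hmn
      rw [this]
      exact tendsto_atTop_iSup fun m n hmn => ENNReal.tsum_le_tsum fun j => hmono _ hmn
  have hR : Filter.Tendsto (fun n => eexpNeg (lam * ∫⁻ x, 1 - eexpNeg (f n x))) Filter.atTop
      (nhds (eexpNeg (lam * ∫⁻ x, 1 - eexpNeg (g x)))) := by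
    refine (continuous_eexpNeg.tendsto _).comp ?_
    refine ENNReal.Tendsto.const_mul ?_ (.inr (by simp))
    refine lintegral_tendsto_of_tendsto_of_monotone (fun n => ?_) (.of_forall fun x => ?_)
      (.of_forall fun x => ?_)
    · exact (measurable_const.sub (measurable_eexpNeg.comp (hfm n))).aemeasurable
    · exact fun m n hmn => tsub_le_tsub_left (eexpNeg_antitone (hmono x hmn)) 1
    · exact ENNReal.Tendsto.sub tendsto_const_nhds ((continuous_eexpNeg.tendsto _).comp (hlim x))
        (.inl (by simp))
  simp_rw [hkey] at hL
  exact tendsto_nhds_unique hL hR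

end PointProcess

/-! ### Independent marks -/

theorem ProbabilityTheory.IndepFun.lintegral_comp_prodMk {Ω α β : Type*} [MeasurableSpace Ω]
    [MeasurableSpace α] [MeasurableSpace β] {Pr : Measure Ω} [IsProbabilityMeasure Pr]
    {U : Ω → α} {V : Ω → β} (h : IndepFun U V Pr) (hU : Measurable U) (hV : Measurable V)
    {F : α × β → ℝ≥0∞} (hF : Measurable F) :
    ∫⁻ ω, F (U ω, V ω) ∂Pr = ∫⁻ ω, ∫⁻ ω', F (U ω, V ω') ∂Pr ∂Pr := by
  have := Measure.isProbabilityMeasure_map (μ := Pr) hV.aemeasurable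
  rw [← lintegral_map (f := F) hF (hU.prodMk hV),
    h.map_prod_eq_prod_map_map hU.aemeasurable hV.aemeasurable,
    lintegral_prod _ hF.aemeasurable, lintegral_map hF.lintegral_prod_right' hU]
  congr 1 with ω
  rw [lintegral_map (by fun_prop) hV]

theorem lintegral_prod_comp_of_iIndepFun {Ω α : Type*} [MeasurableSpace Ω] [MeasurableSpace α]
    {Pr : Measure Ω} {ρ : Measure α} {Y : ℕ → Ω → α} (hY : iIndepFun Y Pr)
    (hm : ∀ j, Measurable (Y j)) (hlaw : ∀ j, HasLaw (Y j) ρ Pr) (s : Finset ℕ)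
    {f : ℕ → α → ℝ≥0∞} (hf : ∀ j, Measurable (f j)) :
    ∫⁻ ω, ∏ j ∈ s, f j (Y j ω) ∂Pr = ∏ j ∈ s, ∫⁻ y, f j y ∂ρ := by
  refine (lintegral_prod_eq_prod_lintegral_of_indepFun s _ (hY.comp f hf)
    fun j => (hf j).comp (hm j)).trans ?_
  refine Finset.prod_congr rfl fun j _ => ?_
  rw [← (hlaw j).map_eq, lintegral_map (hf j) (hm j)]
  rfl

section Field

variable {Ω : Type*} [MeasurableSpace Ω] {Pr : Measure Ω} [IsProbabilityMeasure Pr] {lam : ℝ≥0}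
  {ν : Measure (ℝ × ℝ)} {X : ℕ → Ω → Plane} {P a h : ℕ → Ω → ℝ}

theorem IsInterfererField.isProbabilityMeasure (hF : IsInterfererField Pr lam ν X P a h) :
    IsProbabilityMeasure ν := by
  rw [← (hF.mark_law 0).map_eq]
  exact Measure.isProbabilityMeasure_map (hF.mark_law 0).aemeasurable

/-- Freezing the pairs (P, a), the gains are integrated out factor by factor; the resulting
functions of the pairs again factorize. -/
theorem IsInterfererField.lintegral_prod_marks (hF : IsInterfererField Pr lam ν X P a h)
    (n : ℕ) {f : ℕ → (ℝ × ℝ) × ℝ → ℝ≥0∞} (hf : ∀ j, Measurable (f j)) :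
    ∫⁻ ω, ∏ j ∈ Finset.range n, f j ((P j ω, a j ω), h j ω) ∂Pr =
      ∏ j ∈ Finset.range n, ∫⁻ q, ∫⁻ t, f j (q, t) ∂(expMeasure 1) ∂ν := by
  have : IsProbabilityMeasure (expMeasure 1) := isProbabilityMeasure_expMeasure one_pos
  have hmark (j : ℕ) : Measurable fun ω => (P j ω, a j ω) :=
    (hF.measurable_power j).prodMk (hF.measurable_radius j)
  rw [hF.indep_marks_gains.lintegral_comp_prodMk
    (F := fun z : (ℕ → ℝ × ℝ) × (ℕ → ℝ) => ∏ j ∈ Finset.range n, f j (z.1 j, z.2 j))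
    (measurable_pi_lambda _ hmark) (measurable_pi_lambda _ hF.measurable_gain)
    (Finset.measurable_fun_prod _ fun j _ => (hf j).comp (by fun_prop))]
  have h1 (ω : Ω) := lintegral_prod_comp_of_iIndepFun hF.gain_indep hF.measurable_gain hF.gain_law
    (Finset.range n) (f := fun j t => f j ((P j ω, a j ω), t)) fun j => (hf j).comp (by fun_prop)
  simp only [h1]
  exact lintegral_prod_comp_of_iIndepFun hF.mark_indep hmark hF.mark_law (Finset.range n)
    (f := fun j q => ∫⁻ t, f j (q, t) ∂(expMeasure 1)) fun j => (hf j).lintegral_prod_right'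

/-- The Laplace functional of the independently marked point process. -/
theorem IsInterfererField.lintegral_eexpNeg (hF : IsInterfererField Pr lam ν X P a h)
    {w : Plane × ((ℝ × ℝ) × ℝ) → ℝ≥0∞} (hw : Measurable w) :
    ∫⁻ ω, eexpNeg (∑' j, w (X j ω, ((P j ω, a j ω), h j ω))) ∂Pr =
      eexpNeg (lam * ∫⁻ x, 1 - ∫⁻ q, ∫⁻ t, eexpNeg (w (x, (q, t))) ∂(expMeasure 1) ∂ν) := by
  have : IsProbabilityMeasure (expMeasure 1) := isProbabilityMeasure_expMeasure one_pos
  have := hF.isProbabilityMeasure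
  set φ : Plane → ℝ≥0∞ := fun x => ∫⁻ q, ∫⁻ t, eexpNeg (w (x, (q, t))) ∂(expMeasure 1) ∂ν with hφ
  have hφm : Measurable φ := by
    have h2 : Measurable fun z : Plane × (ℝ × ℝ) =>
        ∫⁻ t, eexpNeg (w (z.1, (z.2, t))) ∂(expMeasure 1) :=
      Measurable.lintegral_prod_right'
        (f := fun z : (Plane × (ℝ × ℝ)) × ℝ => eexpNeg (w (z.1.1, (z.1.2, z.2)))) (by fun_prop)
    exact h2.lintegral_prod_right'
  have hφ1 (x : Plane) : φ x ≤ 1 := by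
    calc φ x ≤ ∫⁻ q, ∫⁻ t, 1 ∂(expMeasure 1) ∂ν :=
          lintegral_mono fun q => lintegral_mono fun t => eexpNeg_le_one _
      _ = 1 := by simp
  have hM (j : ℕ) : Measurable fun ω => ((P j ω, a j ω), h j ω) :=
    ((hF.measurable_power j).prodMk (hF.measurable_radius j)).prodMk (hF.measurable_gain j)
  have hX := hF.ppp.measurable
  -- Given the positions, the marks average out to ∏ φ(X j). Writing φ = e^{-g} with g = -log φ
  -- reduces the marked process to the unmarked functional; φ = 0 corresponds to g = ∞.
  have hfin (n : ℕ) :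
      ∫⁻ ω, ∏ j ∈ Finset.range n, eexpNeg (w (X j ω, ((P j ω, a j ω), h j ω))) ∂Pr =
        ∫⁻ ω, ∏ j ∈ Finset.range n, eexpNeg (eNegLog (φ (X j ω))) ∂Pr := by
    rw [hF.indep_points.lintegral_comp_prodMk
      (F := fun z : (ℕ → Plane) × (ℕ → (ℝ × ℝ) × ℝ) =>
        ∏ j ∈ Finset.range n, eexpNeg (w (z.1 j, z.2 j)))
      (measurable_pi_lambda _ hX) (measurable_pi_lambda _ hM)
      (Finset.measurable_fun_prod _ fun j _ => by fun_prop)]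
    congr 1 with ω
    rw [hF.lintegral_prod_marks n (f := fun j m => eexpNeg (w (X j ω, m))) fun j => by fun_prop]
    exact Finset.prod_congr rfl fun j _ => by rw [eexpNeg_eNegLog (hφ1 _)]
  -- Only finite products are factorized; domination by 1 carries both sides to the full sum.
  have hlim {g : ℕ → Ω → ℝ≥0∞} (hg : ∀ j, Measurable (g j)) :
      Filter.Tendsto (fun n => ∫⁻ ω, ∏ j ∈ Finset.range n, eexpNeg (g j ω) ∂Pr) Filter.atTop
        (nhds (∫⁻ ω, eexpNeg (∑' j, g j ω) ∂Pr)) := by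
    refine tendsto_lintegral_of_dominated_convergence 1
      (fun n => Finset.measurable_fun_prod _ fun j _ => measurable_eexpNeg.comp (hg j))
      (fun n => .of_forall fun ω => ?_) (by simp) (.of_forall fun ω => tendsto_prod_eexpNeg _)
    exact Finset.prod_le_one' fun j _ => eexpNeg_le_one _
  have h1 := hlim (g := fun j ω => w (X j ω, ((P j ω, a j ω), h j ω)))
    fun j => hw.comp ((hX j).prodMk (hM j))
  have h2 := hlim (g := fun j ω => eNegLog (φ (X j ω))) fun j => by
    have := hX j
    fun_prop
  simp only [hfin] at h1
  rw [tendsto_nhds_unique h1 h2, hF.ppp.lintegral_eexpNeg (g := fun x => eNegLog (φ x))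
    (by fun_prop)]
  simp_rw [fun x => eexpNeg_eNegLog (hφ1 x)]
  rfl

/-- The intensity integral in the Laplace functional, with the order of integration exchanged. -/
theorem lintegral_one_sub_lintegral {α β : Type*} [MeasurableSpace α] [MeasurableSpace β]
    {μ : Measure α} [SFinite μ] {ρ : Measure β} [IsProbabilityMeasure ρ] {ψ : α × β → ℝ≥0∞}
    (hψ : Measurable ψ) (hψ1 : ∀ z, ψ z ≤ 1) :
    ∫⁻ x, 1 - ∫⁻ q, ψ (x, q) ∂ρ ∂μ = ∫⁻ q, ∫⁻ x, 1 - ψ (x, q) ∂μ ∂ρ := by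
  rw [← lintegral_lintegral_swap (f := fun x q => 1 - ψ (x, q))
    (Measurable.aemeasurable (f := fun z => 1 - ψ z) (measurable_const.sub hψ))]
  congr 1 with x
  rw [lintegral_sub (g := fun q => ψ (x, q)) (hψ.comp measurable_prodMk_left)]
  · simp
  · refine ((lintegral_mono fun q => hψ1 (x, q)).trans_lt ?_).ne
    simp
  · exact .of_forall fun q => hψ1 _

end Field

/-! ### Euler's integral and the continuation of the hypergeometric series -/

section Hypergeometric

/-- Euler's integral `∫₀¹ u ^ (b - 1) / (1 - x u) du`. -/
noncomputable def eulerIntegral (b x : ℝ) : ℝ :=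
  ∫ u in Set.Ioc (0 : ℝ) 1, u ^ (b - 1) / (1 - x * u)

theorem integrableOn_rpow_sub_one {b : ℝ} (hb : 0 < b) :
    IntegrableOn (fun u : ℝ => u ^ (b - 1)) (Set.Ioc 0 1) :=
  (intervalIntegrable_iff_integrableOn_Ioc_of_le zero_le_one).1
    (intervalIntegral.intervalIntegrable_rpow' (by linarith))

theorem min_le_one_sub_mul {x u : ℝ} (hu : u ∈ Set.Ioc (0 : ℝ) 1) :
    min 1 (1 - x) ≤ 1 - x * u := by
  rcases le_total x 0 with h | h
  · exact (min_le_left _ _).trans (by nlinarith [hu.1])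
  · exact (min_le_right _ _).trans (by nlinarith [hu.2])

theorem one_sub_mul_pos {x u : ℝ} (hx : x < 1) (hu : u ∈ Set.Ioc (0 : ℝ) 1) : 0 < 1 - x * u :=
  (lt_min one_pos (sub_pos.2 hx)).trans_le (min_le_one_sub_mul hu)

/-- On (0, 1] the quotient u / (1 - x u) is at most its value 1 / (1 - x) at u = 1, which gives a
geometric majorant in `n`. -/
theorem norm_eulerTerm_le {b x : ℝ} (hx : x < 1) (y : ℝ) (n : ℕ) {u : ℝ}
    (hu : u ∈ Set.Ioc (0 : ℝ) 1) :
    ‖u ^ (b - 1) * ((y * u / (1 - x * u)) ^ n / (1 - x * u))‖ ≤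
      (|y| / (1 - x)) ^ n / min 1 (1 - x) * u ^ (b - 1) := by
  have h1 := one_sub_mul_pos hx hu
  have hm : 0 < min 1 (1 - x) := lt_min one_pos (sub_pos.2 hx)
  have h2 : |y * u / (1 - x * u)| ≤ |y| / (1 - x) := by
    rw [abs_div, abs_mul, abs_of_pos h1, abs_of_pos hu.1, div_le_div_iff₀ h1 (sub_pos.2 hx),
      mul_assoc]
    exact mul_le_mul_of_nonneg_left (by nlinarith [hu.2]) (abs_nonneg y)
  rw [norm_mul, norm_div, norm_pow, Real.norm_eq_abs, Real.norm_eq_abs, Real.norm_eq_abs,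
    abs_of_pos h1, abs_of_nonneg (Real.rpow_nonneg hu.1.le _), mul_comm]
  refine mul_le_mul_of_nonneg_right ?_ (Real.rpow_nonneg hu.1.le _)
  exact div_le_div₀ (by have := sub_pos.2 hx; positivity) (pow_le_pow_left₀ (abs_nonneg _) h2 n) hm
    (min_le_one_sub_mul hu)

theorem integrableOn_eulerTerm {b x : ℝ} (hb : 0 < b) (hx : x < 1) (y : ℝ) (n : ℕ) :
    IntegrableOn (fun u : ℝ => u ^ (b - 1) * ((y * u / (1 - x * u)) ^ n / (1 - x * u)))
      (Set.Ioc 0 1) := by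
  refine ((integrableOn_rpow_sub_one hb).const_mul
    ((|y| / (1 - x)) ^ n / min 1 (1 - x))).mono' ?_ ?_
  · exact Measurable.aestronglyMeasurable (by fun_prop)
  · filter_upwards [ae_restrict_mem measurableSet_Ioc] with u hu using norm_eulerTerm_le hx y n hu

/-- The geometric series in y u / (1 - x u) expands 1 / (1 - (x + y) u) about x, and the majorant
allows integration term by term. Expansion at every x < 1 gives analyticity; expansion at x = 0
gives the hypergeometric series. -/
theorem hasSum_eulerIntegral {b x y : ℝ} (hb : 0 < b) (hx : x < 1) (hy : |y| < 1 - x) :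
    HasSum (fun n : ℕ => y ^ n *
      ∫ u in Set.Ioc (0 : ℝ) 1, u ^ (b - 1) * ((u / (1 - x * u)) ^ n / (1 - x * u)))
      (eulerIntegral b (x + y)) := by
  have hx' := sub_pos.2 hx
  have hρ : |y| / (1 - x) < 1 := (div_lt_one hx').2 hy
  have hsum : Summable fun n : ℕ => ∫ u in Set.Ioc (0 : ℝ) 1,
      ‖u ^ (b - 1) * ((y * u / (1 - x * u)) ^ n / (1 - x * u))‖ := by
    refine Summable.of_nonneg_of_le (fun n => integral_nonneg fun u => norm_nonneg _)
      (fun n => setIntegral_mono_on (integrableOn_eulerTerm hb hx y n).norm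
        ((integrableOn_rpow_sub_one hb).const_mul _) measurableSet_Ioc
        fun u hu => norm_eulerTerm_le hx y n hu) ?_
    simp_rw [integral_const_mul, div_mul_eq_mul_div, mul_div_assoc]
    exact (summable_geometric_of_lt_one (by positivity) hρ).mul_right _
  have := hasSum_integral_of_summable_integral_norm (fun n => integrableOn_eulerTerm hb hx y n) hsum
  have hval : (∫ u in Set.Ioc (0 : ℝ) 1, ∑' n : ℕ,
      u ^ (b - 1) * ((y * u / (1 - x * u)) ^ n / (1 - x * u))) = eulerIntegral b (x + y) := by
    refine setIntegral_congr_fun measurableSet_Ioc fun u hu => ?_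
    have h1 := one_sub_mul_pos hx hu
    have h2 : |y * u / (1 - x * u)| < 1 := by
      rw [abs_div, abs_mul, abs_of_pos h1, abs_of_pos hu.1, div_lt_one h1]
      nlinarith [hu.1, hu.2]
    have h3 := abs_lt.1 h2
    have h4 : 1 - (x + y) * u = (1 - x * u) * (1 - y * u / (1 - x * u)) := by
      field_simp
      ring
    rw [tsum_mul_left, tsum_div_const, tsum_geometric_of_abs_lt_one h2, h4]
    have : 1 - y * u / (1 - x * u) ≠ 0 := by linarith
    field_simp
  rw [hval] at this
  refine this.congr_fun fun n => ?_
  rw [← integral_const_mul]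
  congr 1 with u
  rw [mul_div_assoc, mul_pow]
  ring

theorem analyticOnNhd_eulerIntegral {b : ℝ} (hb : 0 < b) :
    AnalyticOnNhd ℝ (eulerIntegral b) (Set.Iio 1) := by
  intro x (hx : x < 1)
  refine ⟨FormalMultilinearSeries.ofScalars ℝ fun n =>
    ∫ u in Set.Ioc (0 : ℝ) 1, u ^ (b - 1) * ((u / (1 - x * u)) ^ n / (1 - x * u)), ?_⟩
  rw [hasFPowerSeriesAt_iff]
  filter_upwards [Metric.ball_mem_nhds (0 : ℝ) (sub_pos.2 hx)] with y hy
  simpa [FormalMultilinearSeries.coeff_ofScalars] using hasSum_eulerIntegral hb hx (by simpa using hy)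

/-- Since (1)_n = n!, only (b)_n / (b+1)_n remains, and b (b+1)_n = (b)_{n+1} = (b)_n (b + n). -/
theorem ordinaryHypergeometricCoefficient_one {b : ℝ} (hb : 0 < b) (n : ℕ) :
    ordinaryHypergeometricCoefficient 1 b (b + 1) n = b / (b + n) := by
  have h : b * (ascPochhammer ℝ n).eval (b + 1) = (ascPochhammer ℝ n).eval b * (b + n) := by
    rw [← ascPochhammer_succ_eval, ascPochhammer_succ_left]
    simp
  have h0 : (ascPochhammer ℝ n).eval (b + 1) ≠ 0 := (ascPochhammer_pos n _ (by linarith)).ne'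
  have hn : (n.factorial : ℝ) ≠ 0 := by positivity
  have hbn : b + n ≠ 0 := by positivity
  rw [ordinaryHypergeometricCoefficient, ascPochhammer_eval_one, inv_mul_cancel₀ hn, one_mul,
    ← div_eq_mul_inv, div_eq_div_iff h0 hbn, h]

theorem eulerIntegral_eqOn {b : ℝ} (hb : 0 < b) :
    Set.EqOn (fun x => b * eulerIntegral b x) (ordinaryHypergeometric 1 b (b + 1))
      (Set.Ioo (-1) 1) := by
  intro x hx
  have h := (hasSum_eulerIntegral hb zero_lt_one (y := x) (by simpa [abs_lt] using hx)).mul_left b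
  rw [zero_add] at h
  beta_reduce
  rw [← h.tsum_eq, ordinaryHypergeometric, ordinaryHypergeometric_sum_eq]
  refine tsum_congr fun n => ?_
  have hc := ordinaryHypergeometricCoefficient_one hb n
  rw [ordinaryHypergeometricCoefficient] at hc
  -- At centre 0 the coefficient is ∫ u^{b+n-1} over (0, 1].
  have hi : ∫ u in Set.Ioc (0 : ℝ) 1, u ^ (b - 1) * ((u / (1 - 0 * u)) ^ n / (1 - 0 * u)) =
      1 / (b + n) := by
    have : ∫ u in Set.Ioc (0 : ℝ) 1, u ^ (b - 1) * ((u / (1 - 0 * u)) ^ n / (1 - 0 * u)) =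
        ∫ u in Set.Ioc (0 : ℝ) 1, u ^ (b + n - 1) := by
      refine setIntegral_congr_fun measurableSet_Ioc fun u hu => ?_
      simp only [zero_mul, sub_zero, div_one]
      rw [← Real.rpow_natCast, ← Real.rpow_add hu.1]
      ring_nf
    have hbn : (0 : ℝ) < b + n := by positivity
    rw [this, ← intervalIntegral.integral_of_le zero_le_one, integral_rpow (.inl (by linarith))]
    simp [hbn.ne']
  rw [hc, hi, smul_eq_mul]
  ring

theorem gaussHypergeometric_eq_eulerIntegral {b x : ℝ} (hb : 0 < b) (hx : x < 1) :
    gaussHypergeometric 1 b (b + 1) x = b * eulerIntegral b x :=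
  IsGaussContinuation.gaussHypergeometric_eq
    ⟨analyticOnNhd_const.mul (analyticOnNhd_eulerIntegral hb), eulerIntegral_eqOn hb⟩ hx

end Hypergeometric

/-! ### Exponential gain, polar coordinates and the beta integral -/

section Radial

/-- Tilting the density e^{-t} by e^{-zt} gives (1 + z)⁻¹ times the exponential density of rate 1 +
z. -/
theorem lintegral_eexpNeg_mul_expMeasure {z : ℝ} (hz : 0 ≤ z) :
    ∫⁻ t, eexpNeg (ENNReal.ofReal (z * t)) ∂(expMeasure 1) = ENNReal.ofReal (1 + z)⁻¹ := by
  have hz1 : 0 < 1 + z := by linarith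
  have hm : Measurable (exponentialPDF 1) := (measurable_exponentialPDFReal 1).ennreal_ofReal
  have hm' : Measurable (exponentialPDF (1 + z)) :=
    (measurable_exponentialPDFReal (1 + z)).ennreal_ofReal
  have : expMeasure 1 = volume.withDensity (exponentialPDF 1) := rfl
  rw [this, lintegral_withDensity_eq_lintegral_mul _ hm (by fun_prop)]
  have h (t : ℝ) : (exponentialPDF 1 * fun t => eexpNeg (ENNReal.ofReal (z * t))) t =
      ENNReal.ofReal (1 + z)⁻¹ * exponentialPDF (1 + z) t := by
    rw [Pi.mul_apply]
    rcases lt_or_ge t 0 with ht | ht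
    · simp [exponentialPDF_of_neg ht]
    · rw [exponentialPDF_of_nonneg ht, exponentialPDF_of_nonneg ht, eexpNeg_ofReal (by positivity),
        ← ENNReal.ofReal_mul (by positivity), ← ENNReal.ofReal_mul (by positivity), one_mul,
        ← Real.exp_add, inv_mul_cancel_left₀ hz1.ne']
      ring_nf
  simp_rw [h]
  rw [lintegral_const_mul _ hm', lintegral_exponentialPDF_eq_one hz1, mul_one]

theorem integrable_fun_norm_plane {f : ℝ → ℝ} :
    Integrable (fun x : Plane => f ‖x‖) ↔ IntegrableOn (fun r => r * f r) (Set.Ioi 0) := by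
  simpa using integrable_fun_norm_addHaar (E := Plane) volume (f := f)

theorem integral_fun_norm_plane (f : ℝ → ℝ) :
    ∫ x : Plane, f ‖x‖ = 2 * Real.pi * ∫ r in Set.Ioi 0, r * f r := by
  have h : (volume : Measure Plane).real (Metric.ball 0 1) = Real.pi := by
    simp [Measure.real, EuclideanSpace.volume_ball_fin_two, Real.pi_nonneg]
  simpa [h, mul_assoc] using integral_fun_norm_addHaar (E := Plane) volume f

/-- Pointwise form of r dr = (1/η) y^{-2/η-1} dy for y = r^{-η}, with the Jacobian η r^{-η-1} split
off. -/
theorem mul_comp_rpow_neg_eq {η r : ℝ} (hη : 0 < η) (hr : 0 < r) (f : ℝ → ℝ) :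
    r * f (r ^ (-η)) = (|(-η)| * r ^ (-η - 1)) •
      (fun y => 1 / η * (y ^ (-2 / η - 1) * f y)) (r ^ (-η)) := by
  have : (r ^ (-η)) ^ (-2 / η - 1) = r ^ (2 + η) := by
    rw [← Real.rpow_mul hr.le]
    congr 1
    field_simp
    ring
  have h2 : r ^ (-η - 1) * r ^ (2 + η) = r := by
    rw [← Real.rpow_add hr]
    ring_nf
    exact Real.rpow_one r
  rw [smul_eq_mul, abs_neg, abs_of_pos hη]
  beta_reduce
  rw [this]
  calc r * f (r ^ (-η)) = r ^ (-η - 1) * r ^ (2 + η) * f (r ^ (-η)) := by rw [h2]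
    _ = _ := by field_simp

theorem integrableOn_mul_comp_rpow_neg_iff {η : ℝ} (hη : 0 < η) (f : ℝ → ℝ) :
    IntegrableOn (fun r => r * f (r ^ (-η))) (Set.Ioi 0) ↔
      IntegrableOn (fun y => 1 / η * (y ^ (-2 / η - 1) * f y)) (Set.Ioi 0) := by
  rw [← integrableOn_Ioi_comp_rpow_iff (fun y => 1 / η * (y ^ (-2 / η - 1) * f y))
    (neg_ne_zero.2 hη.ne')]
  exact integrableOn_congr_fun (fun r hr => mul_comp_rpow_neg_eq hη hr f) measurableSet_Ioi

theorem integral_mul_comp_rpow_neg {η : ℝ} (hη : 0 < η) (f : ℝ → ℝ) :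
    ∫ r in Set.Ioi 0, r * f (r ^ (-η)) =
      ∫ y in Set.Ioi 0, 1 / η * (y ^ (-2 / η - 1) * f y) := by
  rw [← integral_comp_rpow_Ioi (fun y => 1 / η * (y ^ (-2 / η - 1) * f y)) (neg_ne_zero.2 hη.ne')]
  exact setIntegral_congr_fun measurableSet_Ioi fun r hr => mul_comp_rpow_neg_eq hη hr f

/-- The beta integral `∫₀^∞ v ^ (b - 1) / (1 + v) dv = π / sin (π b)`. -/
theorem lintegral_rpow_div_one_add {b : ℝ} (hb : 0 < b) (hb1 : b < 1) :
    ∫⁻ v in Set.Ioi (0 : ℝ), ENNReal.ofReal (v ^ (b - 1) / (1 + v)) =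
      ENNReal.ofReal (Real.pi / Real.sin (Real.pi * b)) := by
  have hgamma {a r : ℝ} (ha : 0 < a) (hr : 0 < r) :
      ∫⁻ t in Set.Ioi (0 : ℝ), ENNReal.ofReal (t ^ (a - 1) * Real.exp (-(r * t))) =
        ENNReal.ofReal ((1 / r) ^ a * Real.Gamma a) := by
    rw [← Real.integral_rpow_mul_exp_neg_mul_Ioi ha hr, ofReal_integral_eq_lintegral_ofReal]
    · have := integrableOn_rpow_mul_exp_neg_mul_rpow (p := 1) (s := a - 1) (b := r)
        (by linarith) one_pos hr
      simpa [IntegrableOn] using this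
    · filter_upwards [ae_restrict_mem measurableSet_Ioi] with t ht
      have : (0 : ℝ) < t := ht
      positivity
  -- Inserting 1 / (1 + v) = ∫ e^{-t(1+v)} dt and exchanging the integrals leaves Γ(b) Γ(1 - b), to
  -- which the reflection formula applies.
  have h1 : ∫⁻ v in Set.Ioi (0 : ℝ), ENNReal.ofReal (v ^ (b - 1) / (1 + v)) =
      ∫⁻ v in Set.Ioi (0 : ℝ), ∫⁻ t in Set.Ioi (0 : ℝ),
        ENNReal.ofReal (v ^ (b - 1) * Real.exp (-t) * Real.exp (-(t * v))) := by
    refine setLIntegral_congr_fun measurableSet_Ioi fun v (hv : 0 < v) => ?_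
    have := hgamma (a := 1) (r := 1 + v) one_pos (by linarith)
    simp only [sub_self, Real.rpow_zero, one_mul, Real.rpow_one, Real.Gamma_one, mul_one] at this
    rw [div_eq_mul_one_div, ENNReal.ofReal_mul (by positivity), ← this, ← lintegral_const_mul _
      (by fun_prop)]
    congr 1 with t
    rw [← ENNReal.ofReal_mul (by positivity), mul_assoc, ← Real.exp_add]
    ring_nf
  have h2 : ∫⁻ t in Set.Ioi (0 : ℝ), ∫⁻ v in Set.Ioi (0 : ℝ),
        ENNReal.ofReal (v ^ (b - 1) * Real.exp (-t) * Real.exp (-(t * v))) =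
      ∫⁻ t in Set.Ioi (0 : ℝ), ENNReal.ofReal (Real.Gamma b) *
        ENNReal.ofReal (t ^ ((1 - b) - 1) * Real.exp (-(1 * t))) := by
    refine setLIntegral_congr_fun measurableSet_Ioi fun t (ht : 0 < t) => ?_
    have hc (v : ℝ) : ENNReal.ofReal (v ^ (b - 1) * Real.exp (-t) * Real.exp (-(t * v))) =
        ENNReal.ofReal (Real.exp (-t)) * ENNReal.ofReal (v ^ (b - 1) * Real.exp (-(t * v))) := by
      rw [← ENNReal.ofReal_mul (by positivity)]
      ring_nf
    simp_rw [hc]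
    rw [lintegral_const_mul _ (by fun_prop), hgamma hb ht, ← ENNReal.ofReal_mul (by positivity),
      ← ENNReal.ofReal_mul (Real.Gamma_pos_of_pos hb).le, one_div, Real.inv_rpow ht.le,
      ← Real.rpow_neg ht.le]
    ring_nf
  rw [h1, lintegral_lintegral_swap (Measurable.aemeasurable (by fun_prop)), h2,
    lintegral_const_mul _ (by fun_prop), hgamma (by linarith) one_pos,
    ← ENNReal.ofReal_mul (Real.Gamma_pos_of_pos hb).le, ← Real.Gamma_mul_Gamma_one_sub]
  simp

/-- The finite value in `h` supplies the integrability that transfers the Bochner formulas for polar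
coordinates and substitution to the lower integral. -/
theorem lintegral_fun_norm_plane {η c : ℝ} (hη : 0 < η) {f : ℝ → ℝ} (hf : ∀ y, 0 ≤ y → 0 ≤ f y)
    (hm : Measurable f) (hc : 0 ≤ c)
    (h : ∫⁻ y in Set.Ioi 0, ENNReal.ofReal (1 / η * (y ^ (-2 / η - 1) * f y)) = ENNReal.ofReal c) :
    ∫⁻ x : Plane, ENNReal.ofReal (f (‖x‖ ^ (-η))) = ENNReal.ofReal (2 * Real.pi * c) := by
  have hnn : ∀ y ∈ Set.Ioi (0 : ℝ), 0 ≤ 1 / η * (y ^ (-2 / η - 1) * f y) := fun y hy => by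
    have := hf y (le_of_lt hy)
    have : (0 : ℝ) < y := hy
    positivity
  have hae : 0 ≤ᵐ[volume.restrict (Set.Ioi 0)] fun y => 1 / η * (y ^ (-2 / η - 1) * f y) := by
    filter_upwards [ae_restrict_mem measurableSet_Ioi] with y hy using hnn y hy
  have hms : Measurable fun y => 1 / η * (y ^ (-2 / η - 1) * f y) := by fun_prop
  have hint : IntegrableOn (fun y => 1 / η * (y ^ (-2 / η - 1) * f y)) (Set.Ioi 0) := by
    refine ⟨hms.aestronglyMeasurable, ?_⟩
    rw [hasFiniteIntegral_iff_ofReal hae, h]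
    exact ENNReal.ofReal_lt_top
  have hval : ∫ y in Set.Ioi 0, 1 / η * (y ^ (-2 / η - 1) * f y) = c := by
    rw [integral_eq_lintegral_of_nonneg_ae hae hms.aestronglyMeasurable, h, ENNReal.toReal_ofReal hc]
  rw [← ofReal_integral_eq_lintegral_ofReal, integral_fun_norm_plane (fun r => f (r ^ (-η))),
    integral_mul_comp_rpow_neg hη, hval]
  · rw [integrable_fun_norm_plane (f := fun r => f (r ^ (-η))),
      integrableOn_mul_comp_rpow_neg_iff hη]
    exact hint
  · exact .of_forall fun x => hf _ (by positivity)

end Radial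

/-! ### The contribution of one interferer -/

section Interference

theorem setLIntegral_Ioi_comp_mul_left {c : ℝ} (hc : 0 < c) (F : ℝ → ℝ≥0∞) :
    ∫⁻ y in Set.Ioi (0 : ℝ), F y = ∫⁻ u in Set.Ioi (0 : ℝ), ENNReal.ofReal c * F (c * u) := by
  have himg : (fun u => c * u) '' Set.Ioi (0 : ℝ) = Set.Ioi 0 := by
    rw [Set.image_mul_left_Ioi hc, mul_zero]
  have := lintegral_image_eq_lintegral_abs_deriv_mul (f := fun u => c * u) (f' := fun _ => c)
    (measurableSet_Ioi (a := (0 : ℝ)))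
    (fun u _ => by simpa using ((hasDerivAt_id u).const_mul c).hasDerivWithinAt)
    (mul_right_injective₀ hc.ne').injOn F
  rwa [himg, abs_of_pos hc] at this

/-- Scaling y = a^{-η} u maps the range y < a^{-η}, that is r > a, to u < 1, where the integrand is
Euler's with b = 1 - 2/η. -/
theorem lintegral_exclusion {η z a : ℝ} (hη : 2 < η) (hz : 0 ≤ z) (ha : 0 < a) :
    ∫⁻ y in Set.Ioi (0 : ℝ), ENNReal.ofReal (1 / η * (y ^ (-2 / η - 1) *
      (Set.Iio (a ^ (-η))).indicator (fun y => z * y / (1 + z * y)) y)) =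
    ENNReal.ofReal (a ^ (2 - η) * z / η * eulerIntegral (1 - 2 / η) (-(a ^ (-η) * z))) := by
  have hη0 : 0 < η := by linarith
  have hA : 0 < a ^ (-η) := Real.rpow_pos_of_pos ha _
  have hb : 0 < 1 - 2 / η := by rw [sub_pos, div_lt_one hη0]; exact hη
  have hx : -(a ^ (-η) * z) < 1 := by have := mul_nonneg hA.le hz; linarith
  -- Powers of a from the Jacobian, the weight y^{-2/η-1} and the numerator y.
  have hpow : a ^ (-η) * (a ^ (-η)) ^ (-2 / η - 1) * a ^ (-η) = a ^ (2 - η) := by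
    rw [← Real.rpow_mul ha.le, ← Real.rpow_add ha, ← Real.rpow_add ha]
    congr 1
    field_simp
    ring
  rw [setLIntegral_Ioi_comp_mul_left hA]
  have h1 (u : ℝ) (hu : u ∈ Set.Ioi (0 : ℝ)) : ENNReal.ofReal (a ^ (-η)) * ENNReal.ofReal (1 / η *
      ((a ^ (-η) * u) ^ (-2 / η - 1) * (Set.Iio (a ^ (-η))).indicator
        (fun y => z * y / (1 + z * y)) (a ^ (-η) * u))) =
      (Set.Iio 1).indicator (fun u => ENNReal.ofReal (a ^ (2 - η) * z / η *
        (u ^ (1 - 2 / η - 1) / (1 - -(a ^ (-η) * z) * u)))) u := by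
    have hu0 : 0 < u := hu
    by_cases hu1 : u < 1
    · have hm : a ^ (-η) * u < a ^ (-η) := by nlinarith
      rw [Set.indicator_of_mem (show u ∈ Set.Iio 1 from hu1),
        Set.indicator_of_mem (show a ^ (-η) * u ∈ Set.Iio (a ^ (-η)) from hm),
        ← ENNReal.ofReal_mul hA.le, Real.mul_rpow hA.le hu0.le, ← hpow]
      have : u ^ (1 - 2 / η - 1) = u ^ (-2 / η - 1) * u := by
        rw [← Real.rpow_add_one hu0.ne']
        ring_nf
      rw [this]
      congr 1
      have e : 1 - -(a ^ (-η) * z) * u = 1 + z * (a ^ (-η) * u) := by ring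
      rw [e]
      ring
    · have hm : ¬ a ^ (-η) * u < a ^ (-η) := by nlinarith
      rw [Set.indicator_of_notMem (show u ∉ Set.Iio 1 from hu1),
        Set.indicator_of_notMem (show a ^ (-η) * u ∉ Set.Iio (a ^ (-η)) from hm)]
      simp
  rw [setLIntegral_congr_fun measurableSet_Ioi h1, lintegral_indicator measurableSet_Iio,
    Measure.restrict_restrict measurableSet_Iio, Set.inter_comm, Set.Ioi_inter_Iio,
    restrict_Ioo_eq_restrict_Ioc, eulerIntegral, ← integral_const_mul,
    ofReal_integral_eq_lintegral_ofReal]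
  -- Euler's integrand is the term of index 0, where the factor with `y` is 1.
  · simpa [div_eq_mul_inv] using
      (integrableOn_eulerTerm hb hx 0 0).const_mul (a ^ (2 - η) * z / η)
  · filter_upwards [ae_restrict_mem measurableSet_Ioc] with u hu
    have h1 := one_sub_mul_pos hx hu
    have h2 := hu.1
    simp only [Pi.zero_apply]
    positivity

theorem lintegral_no_exclusion {η z : ℝ} (hη : 2 < η) (hz : 0 ≤ z) :
    ∫⁻ y in Set.Ioi (0 : ℝ), ENNReal.ofReal (1 / η * (y ^ (-2 / η - 1) * (z * y / (1 + z * y)))) =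
      ENNReal.ofReal (z ^ (2 / η) / η * (Real.pi / Real.sin (2 * Real.pi / η))) := by
  have hη0 : 0 < η := by linarith
  have hb : 0 < 1 - 2 / η := by rw [sub_pos, div_lt_one hη0]; exact hη
  have hb1 : 1 - 2 / η < 1 := sub_lt_self 1 (by positivity)
  -- The scaling y = u / z needs z > 0; at z = 0 both sides vanish.
  rcases hz.eq_or_lt with rfl | hz
  · simp [Real.zero_rpow (show 2 / η ≠ 0 by positivity)]
  · have hz' : 0 < z⁻¹ := by positivity
    rw [setLIntegral_Ioi_comp_mul_left hz']
    have h1 (u : ℝ) (hu : u ∈ Set.Ioi (0 : ℝ)) : ENNReal.ofReal z⁻¹ * ENNReal.ofReal (1 / η *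
        ((z⁻¹ * u) ^ (-2 / η - 1) * (z * (z⁻¹ * u) / (1 + z * (z⁻¹ * u))))) =
        ENNReal.ofReal (z ^ (2 / η) / η) *
          ENNReal.ofReal (u ^ ((1 - 2 / η) - 1) / (1 + u)) := by
      have hu0 : 0 < u := hu
      have e1 : u ^ (1 - 2 / η - 1) = u ^ (-2 / η - 1) * u := by
        rw [← Real.rpow_add_one hu0.ne']
        ring_nf
      have e2 : z ^ (2 / η) = z⁻¹ * z⁻¹ ^ (-2 / η - 1) := by
        rw [mul_comm, ← Real.rpow_add_one hz'.ne', Real.inv_rpow hz.le, ← Real.rpow_neg hz.le]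
        ring_nf
      rw [← ENNReal.ofReal_mul hz'.le, ← ENNReal.ofReal_mul (by positivity),
        Real.mul_rpow hz'.le hu0.le, mul_inv_cancel_left₀ hz.ne', e1, e2]
      ring_nf
    rw [setLIntegral_congr_fun measurableSet_Ioi h1, lintegral_const_mul _ (by fun_prop),
      lintegral_rpow_div_one_add hb hb1, ← ENNReal.ofReal_mul (by positivity)]
    rw [show Real.pi * (1 - 2 / η) = Real.pi - 2 * Real.pi / η by ring, Real.sin_pi_sub]

/-- The contribution `s P h r ^ (-η) 1{r > a}` of an interferer with power and radius `m.2.1`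
and gain `m.2.2` at the point `m.1`. -/
noncomputable def interfererTerm (η s : ℝ) (m : Plane × ((ℝ × ℝ) × ℝ)) : ℝ≥0∞ :=
  ENNReal.ofReal s * ENNReal.ofReal
    (if m.2.1.2 < ‖m.1‖ then m.2.1.1 * m.2.2 * ‖m.1‖ ^ (-η) else 0)

theorem measurable_interfererTerm (η s : ℝ) : Measurable (interfererTerm η s) := by
  refine measurable_const.mul (Measurable.ennreal_ofReal (Measurable.ite ?_ ?_ measurable_const))
  · exact measurableSet_lt (by fun_prop) (by fun_prop)
  · fun_prop

theorem one_sub_lintegral_interfererTerm {η s p a : ℝ} (hs : 0 ≤ s) (hp : 0 ≤ p) (x : Plane) :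
    1 - ∫⁻ t, eexpNeg (interfererTerm η s (x, ((p, a), t))) ∂(expMeasure 1) =
      ENNReal.ofReal (if a < ‖x‖ then
        s * p * ‖x‖ ^ (-η) / (1 + s * p * ‖x‖ ^ (-η)) else 0) := by
  have : IsProbabilityMeasure (expMeasure 1) := isProbabilityMeasure_expMeasure one_pos
  have hy : 0 ≤ s * p * ‖x‖ ^ (-η) := by positivity
  by_cases hx : a < ‖x‖
  · have h (t : ℝ) : interfererTerm η s (x, ((p, a), t)) =
        ENNReal.ofReal (s * p * ‖x‖ ^ (-η) * t) := by
      simp only [interfererTerm, hx, if_true]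
      rw [← ENNReal.ofReal_mul hs]
      ring_nf
    simp_rw [h]
    rw [lintegral_eexpNeg_mul_expMeasure hy, if_pos hx, ← ENNReal.ofReal_one,
      ← ENNReal.ofReal_sub _ (by positivity)]
    congr 1
    field_simp
    ring
  · simp [interfererTerm, hx]

/-- The nonnegativity is recorded because `ENNReal.ofReal` would hide a negative value. -/
theorem lintegral_interfererTerm_of_pos {η s p a : ℝ} (hη : 2 < η) (hs : 0 ≤ s) (hp : 0 ≤ p)
    (ha : 0 < a) :
    ∫⁻ x, 1 - ∫⁻ t, eexpNeg (interfererTerm η s (x, ((p, a), t))) ∂(expMeasure 1) =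
      ENNReal.ofReal (2 * Real.pi / (η - 2) * exclusionTerm η s p a) ∧
    0 ≤ exclusionTerm η s p a := by
  have hη0 : 0 < η := by linarith
  have hη2 : 0 < η - 2 := by linarith
  have hz : 0 ≤ s * p := mul_nonneg hs hp
  have hA : 0 < a ^ (-η) := Real.rpow_pos_of_pos ha _
  have hb : 0 < 1 - 2 / η := by rw [sub_pos, div_lt_one hη0]; exact hη
  have hx : -(a ^ (-η) * (s * p)) < 1 := by have := mul_nonneg hA.le hz; linarith
  have hE : 0 ≤ eulerIntegral (1 - 2 / η) (-(a ^ (-η) * (s * p))) := by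
    refine setIntegral_nonneg measurableSet_Ioc fun u hu => ?_
    exact div_nonneg (Real.rpow_nonneg hu.1.le _) (one_sub_mul_pos hx hu).le
  -- The factor b = (η - 2)/η in front of Euler's integral produces η - 2, which cancels the
  -- denominator in the exponent.
  have hterm : exclusionTerm η s p a = (η - 2) * (a ^ (2 - η) * (s * p) / η *
      eulerIntegral (1 - 2 / η) (-(a ^ (-η) * (s * p)))) := by
    have e : a ^ (-η) * p * s = a ^ (-η) * (s * p) := by ring
    rw [exclusionTerm, e, show 2 - 2 / η = (1 - 2 / η) + 1 by ring,
      gaussHypergeometric_eq_eulerIntegral hb hx]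
    field_simp
  refine ⟨?_, by rw [hterm]; positivity⟩
  have h := lintegral_fun_norm_plane hη0
    (f := (Set.Iio (a ^ (-η))).indicator (fun y => s * p * y / (1 + s * p * y)))
    (fun y hy => Set.indicator_apply_nonneg fun _ => by positivity)
    (Measurable.indicator (by fun_prop) measurableSet_Iio) (by positivity)
    (lintegral_exclusion hη hz ha)
  rw [hterm, ← mul_assoc (2 * Real.pi / (η - 2)), div_mul_cancel₀ _ hη2.ne', ← h]
  congr 1 with x
  rw [one_sub_lintegral_interfererTerm hs hp, Set.indicator_apply]
  congr 1
  -- At the origin the real power 0^{-η} is 0, not ∞; both sides are 0 there.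
  rcases (norm_nonneg x).eq_or_lt with h0 | h0
  · simp [← h0, ha.not_gt, Real.zero_rpow (neg_ne_zero.2 hη0.ne')]
  · have : a < ‖x‖ ↔ ‖x‖ ^ (-η) ∈ Set.Iio (a ^ (-η)) :=
      (Real.rpow_lt_rpow_iff_of_neg h0 ha (neg_lt_zero.2 hη0)).symm
    simp only [this]

theorem lintegral_interfererTerm_of_zero {η s p : ℝ} (hη : 2 < η) (hs : 0 ≤ s) (hp : 0 ≤ p) :
    ∫⁻ x, 1 - ∫⁻ t, eexpNeg (interfererTerm η s (x, ((p, 0), t))) ∂(expMeasure 1) =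
      ENNReal.ofReal (2 * Real.pi ^ 2 / η * (Real.sin (2 * Real.pi / η))⁻¹ * (s * p) ^ (2 / η)) := by
  have hη0 : 0 < η := by linarith
  have hz : 0 ≤ s * p := mul_nonneg hs hp
  have hsin : 0 < Real.sin (2 * Real.pi / η) := by
    refine Real.sin_pos_of_pos_of_lt_pi (by positivity) ?_
    rw [div_lt_iff₀ hη0]
    nlinarith [Real.pi_pos]
  have h := lintegral_fun_norm_plane hη0 (f := fun y => s * p * y / (1 + s * p * y))
    (fun y hy => by positivity) (by fun_prop) (by positivity) (lintegral_no_exclusion hη hz)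
  have e : 2 * Real.pi ^ 2 / η * (Real.sin (2 * Real.pi / η))⁻¹ * (s * p) ^ (2 / η) =
    2 * Real.pi * ((s * p) ^ (2 / η) / η * (Real.pi / Real.sin (2 * Real.pi / η))) := by ring
  rw [e, ← h]
  congr 1 with x
  rw [one_sub_lintegral_interfererTerm hs hp]
  congr 1
  rcases (norm_nonneg x).eq_or_lt with h0 | h0
  · simp [← h0, Real.zero_rpow (neg_ne_zero.2 hη0.ne')]
  · rw [if_pos h0]

/-- Passage from [0, ∞] to a real expectation. `T` is a.e. a multiple of the measurable `K`, so for
a nonnegative `T` non-integrability can only mean an infinite integral, and λ > 0 keeps the exponent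
infinite. -/
theorem expNeg_mul_lintegral {α : Type*} [MeasurableSpace α] {ν : Measure α} {lam : ℝ≥0}
    (hlam : 0 < lam) {K : α → ℝ≥0∞} (hK : Measurable K) {T : α → ℝ} {κ : ℝ} (hκ : 0 < κ)
    (hT : ∀ᵐ q ∂ν, 0 ≤ T q) (hKT : ∀ᵐ q ∂ν, K q = ENNReal.ofReal (κ * T q)) :
    (Integrable T ν → expNeg (lam * ∫⁻ q, K q ∂ν) = Real.exp (-(lam * κ * ∫ q, T q ∂ν))) ∧
    (¬ Integrable T ν → expNeg (lam * ∫⁻ q, K q ∂ν) = 0) := by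
  have hTm : AEStronglyMeasurable T ν := by
    refine ⟨fun q => κ⁻¹ * (K q).toReal,
      (hK.ennreal_toReal.const_mul _).stronglyMeasurable, ?_⟩
    filter_upwards [hT, hKT] with q h1 h2
    rw [h2, ENNReal.toReal_ofReal (by positivity), inv_mul_cancel_left₀ hκ.ne']
  have hI : ∫⁻ q, K q ∂ν = ENNReal.ofReal κ * ∫⁻ q, ENNReal.ofReal (T q) ∂ν := by
    rw [← lintegral_const_mul'' _ hTm.aemeasurable.ennreal_ofReal]
    refine lintegral_congr_ae ?_
    filter_upwards [hKT] with q h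
    rw [h, ENNReal.ofReal_mul hκ.le]
  constructor
  · intro hint
    have h0 : 0 ≤ ∫ q, T q ∂ν := integral_nonneg_of_ae hT
    have : (lam : ℝ≥0∞) * ∫⁻ q, K q ∂ν = ENNReal.ofReal (lam * κ * ∫ q, T q ∂ν) := by
      rw [hI, ← ofReal_integral_eq_lintegral_ofReal hint hT, ENNReal.ofReal_mul (by positivity),
        ENNReal.ofReal_mul (by positivity), ENNReal.ofReal_coe_nnreal, mul_assoc]
    rw [← toReal_eexpNeg, this, eexpNeg_ofReal (by positivity),
      ENNReal.toReal_ofReal (Real.exp_pos _).le]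
  · intro hint
    have : ∫⁻ q, ENNReal.ofReal (T q) ∂ν = ∞ := by
      by_contra h
      exact hint ⟨hTm, (hasFiniteIntegral_iff_ofReal hT).2 (lt_top_iff_ne_top.2 h)⟩
    rw [hI, this, ENNReal.mul_top (by simpa using hκ), ENNReal.mul_top (by simpa using hlam.ne')]
    simp [expNeg]

theorem IsInterfererField.laplaceTransform_eq {Ω : Type*} [MeasurableSpace Ω] {Pr : Measure Ω}
    [IsProbabilityMeasure Pr] {lam : ℝ≥0} {ν : Measure (ℝ × ℝ)} {X : ℕ → Ω → Plane}
    {P a h : ℕ → Ω → ℝ} (hF : IsInterfererField Pr lam ν X P a h) (η s : ℝ) :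
    Measurable (fun q : ℝ × ℝ =>
      ∫⁻ x : Plane, 1 - ∫⁻ t, eexpNeg (interfererTerm η s (x, (q, t))) ∂(expMeasure 1)) ∧
    laplaceTransform Pr (aggregateInterference η X P a h) s = expNeg (lam *
      ∫⁻ q : ℝ × ℝ, (∫⁻ x : Plane,
        1 - ∫⁻ t, eexpNeg (interfererTerm η s (x, (q, t))) ∂(expMeasure 1)) ∂ν) := by
  have : IsProbabilityMeasure (expMeasure 1) := isProbabilityMeasure_expMeasure one_pos
  have := hF.isProbabilityMeasure
  have hw := measurable_interfererTerm η s
  have hψ : Measurable fun z : Plane × (ℝ × ℝ) =>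
      ∫⁻ t, eexpNeg (interfererTerm η s (z.1, (z.2, t))) ∂(expMeasure 1) :=
    Measurable.lintegral_prod_right'
      (f := fun z : (Plane × (ℝ × ℝ)) × ℝ => eexpNeg (interfererTerm η s (z.1.1, (z.1.2, z.2))))
      (by fun_prop)
  refine ⟨Measurable.lintegral_prod_left' (f := fun z : Plane × (ℝ × ℝ) =>
    1 - ∫⁻ t, eexpNeg (interfererTerm η s (z.1, (z.2, t))) ∂(expMeasure 1))
    (measurable_const.sub hψ), ?_⟩
  have hψ1 (z : Plane × (ℝ × ℝ)) :
      ∫⁻ t, eexpNeg (interfererTerm η s (z.1, (z.2, t))) ∂(expMeasure 1) ≤ 1 :=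
    (lintegral_mono fun t => eexpNeg_le_one _).trans (by simp)
  have hI (ω : Ω) : ENNReal.ofReal s * aggregateInterference η X P a h ω =
      ∑' j, interfererTerm η s (X j ω, ((P j ω, a j ω), h j ω)) := by
    rw [aggregateInterference, ← ENNReal.tsum_mul_left]
    rfl
  have hm : Measurable fun ω => ∑' j, interfererTerm η s (X j ω, ((P j ω, a j ω), h j ω)) :=
    Measurable.tsum fun j => hw.comp ((hF.ppp.measurable j).prodMk
      (((hF.measurable_power j).prodMk (hF.measurable_radius j)).prodMk (hF.measurable_gain j)))
  rw [← lintegral_one_sub_lintegral hψ hψ1, ← toReal_eexpNeg, ← hF.lintegral_eexpNeg hw,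
    laplaceTransform]
  simp_rw [hI, ← toReal_eexpNeg]
  exact integral_toReal (measurable_eexpNeg.comp hm).aemeasurable
    (.of_forall fun ω => lt_top_iff_ne_top.2 (eexpNeg_ne_top _))

end Interference

/-! ### The two closed forms -/

theorem lemma2 {Ω : Type*} [MeasurableSpace Ω] (Pr : Measure Ω) [IsProbabilityMeasure Pr]
    (lam : ℝ≥0) (hlam : 0 < lam) (η : ℝ) (hη : 2 < η)
    (ν : Measure (ℝ × ℝ)) (X : ℕ → Ω → Plane) (P a h : ℕ → Ω → ℝ)
    (hfield : IsInterfererField Pr lam ν X P a h)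
    (hP : ∀ᵐ q ∂ν, 0 ≤ q.1) (s : ℝ) (hs : 0 ≤ s) :
    ((∀ᵐ q ∂ν, 0 < q.2) →
      (Integrable (fun q : ℝ × ℝ => exclusionTerm η s q.1 q.2) ν →
        laplaceTransform Pr (aggregateInterference η X P a h) s =
          Real.exp (-2 * Real.pi * lam / (η - 2) * ∫ q, exclusionTerm η s q.1 q.2 ∂ν)) ∧
      (¬ Integrable (fun q : ℝ × ℝ => exclusionTerm η s q.1 q.2) ν →
        laplaceTransform Pr (aggregateInterference η X P a h) s = 0)) ∧
    ((∀ᵐ q ∂ν, q.2 = 0) →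
      (Integrable (fun q : ℝ × ℝ => (s * q.1) ^ (2 / η)) ν →
        laplaceTransform Pr (aggregateInterference η X P a h) s =
          Real.exp (-(2 * Real.pi ^ 2 * lam / η) * (∫ q, (s * q.1) ^ (2 / η) ∂ν) *
            (Real.sin (2 * Real.pi / η))⁻¹)) ∧
      (¬ Integrable (fun q : ℝ × ℝ => (s * q.1) ^ (2 / η)) ν →
        laplaceTransform Pr (aggregateInterference η X P a h) s = 0)) := by
  obtain ⟨hK, hL⟩ := hfield.laplaceTransform_eq η s
  have hη0 : 0 < η := by linarith
  rw [hL]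
  constructor
  · intro ha
    have hη2 : 0 < η - 2 := by linarith
    have hκ : 0 < 2 * Real.pi / (η - 2) := by positivity
    have := expNeg_mul_lintegral hlam hK (T := fun q : ℝ × ℝ => exclusionTerm η s q.1 q.2) hκ
      (by filter_upwards [hP, ha] with q h1 h2 using
        (lintegral_interfererTerm_of_pos hη hs h1 h2).2)
      (by filter_upwards [hP, ha] with q h1 h2 using
        (lintegral_interfererTerm_of_pos hη hs h1 h2).1)
    refine ⟨fun hint => ?_, this.2⟩
    rw [this.1 hint]
    congr 1
    ring
  · intro ha
    have hsin : 0 < Real.sin (2 * Real.pi / η) := by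
      refine Real.sin_pos_of_pos_of_lt_pi (by positivity) ?_
      rw [div_lt_iff₀ hη0]
      nlinarith [Real.pi_pos]
    have hκ : 0 < 2 * Real.pi ^ 2 / η * (Real.sin (2 * Real.pi / η))⁻¹ := by positivity
    have := expNeg_mul_lintegral hlam hK (T := fun q : ℝ × ℝ => (s * q.1) ^ (2 / η)) hκ
      (by filter_upwards [hP] with q h1 using Real.rpow_nonneg (mul_nonneg hs h1) _)
      (by
        filter_upwards [hP, ha] with q h1 h2
        obtain ⟨p, r⟩ := q
        obtain rfl : r = 0 := h2
        exact lintegral_interfererTerm_of_zero hη hs h1)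
    refine ⟨fun hint => ?_, this.2⟩
    rw [this.1 hint]
    congr 1
    ring
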